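/- Let $\Bbbk$ be a field of characteristic zero. Let $W$ be the Witt algebra, i.e. the Lie $\Bbbk$-algebra with basis $\{e_n : n\in\mathbb Z\}$ and bracket $[e_n,e_m]=(m-n)e_{n+m}$; let $W_+=\operatorname{span}_{\Bbbk}(e_n : n\ge 1)$ (the positive Witt algebra) and $\mathbf W_1=\operatorname{span}_{\Bbbk}(e_n : n\ge -1)$ (the Cartan algebra), both Lie subalgebras of $W$; and let $V\!ir$ be the Virasoro algebra, i.e. the Lie $\Bbbk$-algebra with basis $\{e_n : n\in\mathbb Z\}\cup\{z\}$ and bracket $[e_n,e_m]=(m-n)e_{n+m}+\frac{n^3-n}{12}\,\delta_{n+m,0}\,z$, $[e_n,z]=0$. For a Lie algebra $\mathfrak g$, equip the symmetric algebra $S(\mathfrak g)$ with its natural Poisson bracket $\{-,-\}$, the one that extends the Lie bracket of $\mathfrak g$; a Poisson ideal is an ideal $I$ of the commutative algebra $S(\mathfrak g)$ with $\{S(\mathfrak g),I\}\subseteq I$. Let $\mathfrak g$ be one of $W$, $W_+$, $\mathbf W_1$, or $V\!ir$. Then $S(\mathfrak g)$ satisfies the ascending chain condition on radical Poisson ideals,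 and every radical Poisson ideal of $S(\mathfrak g)$ is the intersection of a finite set of prime Poisson ideals (the unit ideal being the empty intersection). -/

import Mathlib

noncomputable section

/-! ### Poisson algebras and Poisson ideals -/

/-- A Poisson bracket on a commutative `R`-algebra `A`: an `R`-bilinear Lie bracket on `A`
which is a derivation in its second (hence, by antisymmetry, in each) argument. -/
structure PoissonBracket (R A : Type*) [CommRing R] [CommRing A] [Algebra R A] where
  bracket : A →ₗ[R] A →ₗ[R] A
  self : ∀ a, bracket a a = 0
  jacobi : ∀ a b c,
    bracket a (bracket b c) + bracket b (bracket c a) + bracket c (bracket a b) = 0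
  leibniz : ∀ a b c, bracket a (b * c) = b * bracket a c + c * bracket a b

namespace PoissonBracket

variable {R A : Type*} [CommRing R] [CommRing A] [Algebra R A]

/-- A Poisson ideal: an ideal `I` of the commutative algebra `A` with `{A, I} ⊆ I`. -/
def IsPoissonIdeal (B : PoissonBracket R A) (I : Ideal A) : Prop :=
  ∀ a : A, ∀ f ∈ I, B.bracket a f ∈ I

/-- The ascending chain condition on radical Poisson ideals: every increasing sequence
of radical Poisson ideals is eventually constant. -/
def ACCOnRadicalPoissonIdeals (B : PoissonBracket R A) : Prop :=
  ∀ I : ℕ → Ideal A, (∀ n, (I n).IsRadical ∧ B.IsPoissonIdeal (I n)) →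
    (∀ n, I n ≤ I (n + 1)) → ∃ N, ∀ n, N ≤ n → I n = I N

/-- The ideal `I` is the intersection of a finite set of prime Poisson ideals
(the unit ideal being the intersection of the empty set). -/
def IsFiniteInterOfPrimePoisson (B : PoissonBracket R A) (I : Ideal A) : Prop :=
  ∃ s : Finset (Ideal A), (∀ P ∈ s, P.IsPrime ∧ B.IsPoissonIdeal P) ∧
    I = sInf (s : Set (Ideal A))

end PoissonBracket

/-! ### The Poisson bracket of a symmetric algebra -/

namespace LiePoisson

section Lift

variable {R M : Type*} [CommRing R] [AddCommGroup M] [Module R M]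

theorem derivation_ext {D₁ D₂ : Derivation R (SymmetricAlgebra R M) (SymmetricAlgebra R M)}
    (h : ∀ x, D₁ (SymmetricAlgebra.ι R M x) = D₂ (SymmetricAlgebra.ι R M x)) : D₁ = D₂ := by
  ext a
  induction a using SymmetricAlgebra.induction with
  | algebraMap r => simp
  | ι x => exact h x
  | mul a b ha hb => simp [ha, hb]
  | add a b ha hb => simp [ha, hb]

/-- The algebra homomorphism `a ↦ a + ε D(a)`, where `D` extends `f`. -/
def liftAux (f : M →ₗ[R] SymmetricAlgebra R M) :
    SymmetricAlgebra R M →ₐ[R] TrivSqZeroExt (SymmetricAlgebra R M) (SymmetricAlgebra R M) :=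
  SymmetricAlgebra.lift
    ((TrivSqZeroExt.inlAlgHom R (SymmetricAlgebra R M) (SymmetricAlgebra R M)).toLinearMap ∘ₗ
        SymmetricAlgebra.ι R M +
      (TrivSqZeroExt.inrHom (SymmetricAlgebra R M) (SymmetricAlgebra R M)).restrictScalars R ∘ₗ f)

theorem liftAux_ι (f : M →ₗ[R] SymmetricAlgebra R M) (x : M) :
    liftAux f (SymmetricAlgebra.ι R M x) =
      TrivSqZeroExt.inl (SymmetricAlgebra.ι R M x) + TrivSqZeroExt.inr (f x) := by
  simp [liftAux]

theorem fst_liftAux (f : M →ₗ[R] SymmetricAlgebra R M) (a : SymmetricAlgebra R M) :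
    (liftAux f a).fst = a := by
  induction a using SymmetricAlgebra.induction with
  | algebraMap r => rw [AlgHom.commutes]; rfl
  | ι x => simp [liftAux_ι]
  | mul a b ha hb => rw [map_mul, TrivSqZeroExt.fst_mul, ha, hb]
  | add a b ha hb => rw [map_add, TrivSqZeroExt.fst_add, ha, hb]

/-- The derivation of the symmetric algebra that extends a linear map `f`. -/
def liftDerivation (f : M →ₗ[R] SymmetricAlgebra R M) :
    Derivation R (SymmetricAlgebra R M) (SymmetricAlgebra R M) :=
  Derivation.mk'
    ((TrivSqZeroExt.sndHom (SymmetricAlgebra R M) (SymmetricAlgebra R M)).restrictScalars R ∘ₗ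
      (liftAux f).toLinearMap)
    (fun a b => by simp [fst_liftAux, mul_comm])

@[simp] theorem liftDerivation_ι (f : M →ₗ[R] SymmetricAlgebra R M) (x : M) :
    liftDerivation f (SymmetricAlgebra.ι R M x) = f x := by
  simp [liftDerivation, liftAux_ι]

theorem liftDerivation_add (f g : M →ₗ[R] SymmetricAlgebra R M) :
    liftDerivation (f + g) = liftDerivation f + liftDerivation g :=
  derivation_ext fun x => by simp

theorem liftDerivation_smul (r : R) (f : M →ₗ[R] SymmetricAlgebra R M) :
    liftDerivation (r • f) = r • liftDerivation f :=
  derivation_ext fun x => by simp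

end Lift

variable (R L : Type*) [CommRing R] [LieRing L] [LieAlgebra R L]

/-- The adjoint action of `x` on `L`, extended to a derivation `{x, -}` of `S(L)`. -/
def adDerivation (x : L) : Derivation R (SymmetricAlgebra R L) (SymmetricAlgebra R L) :=
  liftDerivation (SymmetricAlgebra.ι R L ∘ₗ (LieAlgebra.ad R L x : L →ₗ[R] L))

@[simp] theorem adDerivation_ι (x y : L) :
    adDerivation R L x (SymmetricAlgebra.ι R L y) = SymmetricAlgebra.ι R L ⁅x, y⁆ := by
  simp [adDerivation]

/-- For fixed `b`, the linear map `x ↦ {x, b}` on `L`. -/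
def adRight (b : SymmetricAlgebra R L) : L →ₗ[R] SymmetricAlgebra R L where
  toFun x := adDerivation R L x b
  map_add' x y := by
    have : adDerivation R L (x + y) = adDerivation R L x + adDerivation R L y :=
      derivation_ext fun z => by simp
    simp [this]
  map_smul' r x := by
    have : adDerivation R L (r • x) = r • adDerivation R L x :=
      derivation_ext fun z => by simp
    simp [this]

/-- The bilinear map `{a, b}`: for fixed `b` it is the derivation in `a` extending
`x ↦ {x, b}`. -/
def bracketMap : SymmetricAlgebra R L →ₗ[R] SymmetricAlgebra R L →ₗ[R] SymmetricAlgebra R L :=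
  LinearMap.mk₂ R (fun a b => liftDerivation (adRight R L b) a)
    (fun a a' b => by simp)
    (fun r a b => by simp)
    (fun a b b' => by
      have : adRight R L (b + b') = adRight R L b + adRight R L b' := by
        ext x; simp [adRight]
      rw [this, liftDerivation_add]; rfl)
    (fun r a b => by
      have : adRight R L (r • b) = r • adRight R L b := by
        ext x; simp [adRight]
      rw [this, liftDerivation_smul]; rfl)

theorem bracketMap_mul_left (a b c : SymmetricAlgebra R L) :
    bracketMap R L (a * b) c = a * bracketMap R L b c + b * bracketMap R L a c := by
  simp [bracketMap]

theorem bracketMap_algebraMap_left (r : R) (c : SymmetricAlgebra R L) :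
    bracketMap R L (algebraMap R _ r) c = 0 := by
  simp [bracketMap]

theorem bracketMap_ι_left (x : L) (b : SymmetricAlgebra R L) :
    bracketMap R L (SymmetricAlgebra.ι R L x) b = adDerivation R L x b := by
  simp [bracketMap, adRight]

theorem bracketMap_mul_right (a b c : SymmetricAlgebra R L) :
    bracketMap R L a (b * c) = b * bracketMap R L a c + c * bracketMap R L a b := by
  induction a using SymmetricAlgebra.induction with
  | algebraMap r => simp [bracketMap_algebraMap_left]
  | ι x => simp [bracketMap_ι_left]
  | mul a a' ha ha' => simp only [bracketMap_mul_left, ha, ha']; ring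
  | add a a' ha ha' => simp only [map_add, LinearMap.add_apply, ha, ha']; ring

theorem bracketMap_algebraMap_right (r : R) (a : SymmetricAlgebra R L) :
    bracketMap R L a (algebraMap R _ r) = 0 := by
  induction a using SymmetricAlgebra.induction with
  | algebraMap r => simp [bracketMap_algebraMap_left]
  | ι x => simp [bracketMap_ι_left]
  | mul a a' ha ha' => simp [bracketMap_mul_left, ha, ha']
  | add a a' ha ha' => simp [ha, ha']

theorem bracketMap_skew (a b : SymmetricAlgebra R L) :
    bracketMap R L b a = - bracketMap R L a b := by
  induction a using SymmetricAlgebra.induction with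
  | algebraMap r => simp [bracketMap_algebraMap_left, bracketMap_algebraMap_right]
  | ι x =>
    induction b using SymmetricAlgebra.induction with
    | algebraMap r => simp [bracketMap_algebraMap_left, bracketMap_algebraMap_right]
    | ι y =>
      simp only [bracketMap_ι_left, adDerivation_ι]
      rw [← lie_skew, map_neg]
    | mul b b' hb hb' => simp only [bracketMap_mul_left, bracketMap_mul_right, hb, hb']; ring
    | add b b' hb hb' => simp only [map_add, LinearMap.add_apply, hb, hb']; ring
  | mul a a' ha ha' => simp only [bracketMap_mul_left, bracketMap_mul_right, ha, ha']; ring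
  | add a a' ha ha' => simp only [map_add, LinearMap.add_apply, ha, ha']; ring

theorem bracketMap_self (a : SymmetricAlgebra R L) : bracketMap R L a a = 0 := by
  induction a using SymmetricAlgebra.induction with
  | algebraMap r => simp [bracketMap_algebraMap_left]
  | ι x => simp [bracketMap_ι_left]
  | mul a b ha hb =>
    simp only [bracketMap_mul_left, bracketMap_mul_right, ha, hb, bracketMap_skew R L a b]; ring
  | add a b ha hb =>
    simp only [map_add, LinearMap.add_apply, ha, hb, bracketMap_skew R L a b]; ring

theorem bracketMap_leibniz_lie (a b c : SymmetricAlgebra R L) :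
    bracketMap R L a (bracketMap R L b c) =
      bracketMap R L (bracketMap R L a b) c + bracketMap R L b (bracketMap R L a c) := by
  induction a using SymmetricAlgebra.induction with
  | algebraMap r => simp [bracketMap_algebraMap_left]
  | mul a a' ha ha' =>
    simp only [bracketMap_mul_left, bracketMap_mul_right, map_add, LinearMap.add_apply, ha, ha',
      bracketMap_skew R L a b, bracketMap_skew R L a' b]
    ring
  | add a a' ha ha' => simp only [map_add, LinearMap.add_apply, ha, ha']; ring
  | ι x =>
    induction b using SymmetricAlgebra.induction with
    | algebraMap r => simp [bracketMap_algebraMap_left, bracketMap_algebraMap_right]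
    | mul b b' hb hb' =>
      simp only [bracketMap_mul_left, bracketMap_mul_right, map_add, LinearMap.add_apply, hb, hb']
      ring
    | add b b' hb hb' => simp only [map_add, LinearMap.add_apply, hb, hb']; ring
    | ι y =>
      induction c using SymmetricAlgebra.induction with
      | algebraMap r => simp [bracketMap_algebraMap_right]
      | mul c c' hc hc' =>
        simp only [bracketMap_mul_right, map_add, hc, hc']
        ring
      | add c c' hc hc' => simp only [map_add, hc, hc']; ring
      | ι z =>
        simp only [bracketMap_ι_left, adDerivation_ι]
        rw [leibniz_lie, map_add]

/-- The natural Poisson bracket on the symmetric algebra `S(L)` of a Lie algebra `L`: the one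
whose restriction to `L` is the Lie bracket. -/
def poissonBracket : PoissonBracket R (SymmetricAlgebra R L) where
  bracket := bracketMap R L
  self := bracketMap_self R L
  jacobi a b c := by
    have h := bracketMap_leibniz_lie R L a b c
    rw [bracketMap_skew R L c (bracketMap R L a b), bracketMap_skew R L c a, map_neg] at *
    rw [h, bracketMap_skew R L a c, map_neg]
    ring
  leibniz := bracketMap_mul_right R L

theorem poissonBracket_ι (x y : L) :
    (poissonBracket R L).bracket (SymmetricAlgebra.ι R L x) (SymmetricAlgebra.ι R L y) =
      SymmetricAlgebra.ι R L ⁅x, y⁆ := by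
  simp [poissonBracket, bracketMap_ι_left]

end LiePoisson

/-! ### The Witt algebra and its subalgebras -/

theorem basis_induction {K V ι : Type*} [Field K] [AddCommGroup V] [Module K V]
    (b : Module.Basis ι K V) {P : V → Prop} (h0 : P 0) (hb : ∀ i, P (b i))
    (hadd : ∀ x y, P x → P y → P (x + y)) (hsmul : ∀ (c : K) x, P x → P (c • x)) (x : V) :
    P x :=
  Submodule.span_induction (p := fun x _ => P x) (by rintro _ ⟨i, rfl⟩; exact hb i) h0
    (fun x y _ _ => hadd x y) (fun c x _ => hsmul c x) (b.mem_span x)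

/-- The underlying vector space of the Witt algebra, with basis indexed by `ℤ`. -/
def WittAlgebra (K : Type*) [Field K] : Type _ := ℤ →₀ K

namespace WittAlgebra

variable (K : Type*) [Field K]

instance : AddCommGroup (WittAlgebra K) := inferInstanceAs (AddCommGroup (ℤ →₀ K))
instance : Module K (WittAlgebra K) := inferInstanceAs (Module K (ℤ →₀ K))

/-- The standard basis `(e n)` of the Witt algebra. -/
def basis : Module.Basis ℤ K (WittAlgebra K) := ⟨LinearEquiv.refl K (ℤ →₀ K)⟩

/-- The basis element `e n`. -/
def e (n : ℤ) : WittAlgebra K := basis K n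

/-- The bilinear map with `(e n, e m) ↦ (m - n) e (n + m)`. -/
def bracketMap : WittAlgebra K →ₗ[K] WittAlgebra K →ₗ[K] WittAlgebra K :=
  (basis K).constr K fun n => (basis K).constr K fun m => ((m : K) - (n : K)) • e K (n + m)

theorem bracketMap_e (n m : ℤ) :
    bracketMap K (e K n) (e K m) = ((m : K) - (n : K)) • e K (n + m) := by
  simp [bracketMap, e]

theorem bracketMap_skew (x y : WittAlgebra K) : bracketMap K y x = - bracketMap K x y := by
  induction x using basis_induction (basis K) with
  | h0 => simp
  | hadd x x' hx hx' => simp only [map_add, LinearMap.add_apply, hx, hx']; abel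
  | hsmul c x hx => simp [hx]
  | hb n =>
    induction y using basis_induction (basis K) with
    | h0 => simp
    | hadd x x' hx hx' => simp only [map_add, LinearMap.add_apply, hx, hx']; abel
    | hsmul c x hx => simp [hx]
    | hb m =>
      change bracketMap K (e K m) (e K n) = - bracketMap K (e K n) (e K m)
      rw [bracketMap_e, bracketMap_e, add_comm m n, ← neg_smul, neg_sub]

theorem bracketMap_self (x : WittAlgebra K) : bracketMap K x x = 0 := by
  induction x using basis_induction (basis K) with
  | h0 => simp
  | hadd x y hx hy => simp [hx, hy, bracketMap_skew K x y]
  | hsmul c x hx => simp [hx]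
  | hb n => change bracketMap K (e K n) (e K n) = 0; simp [bracketMap_e]

theorem bracketMap_leibniz (x y z : WittAlgebra K) :
    bracketMap K x (bracketMap K y z) =
      bracketMap K (bracketMap K x y) z + bracketMap K y (bracketMap K x z) := by
  induction x using basis_induction (basis K) with
  | h0 => simp
  | hadd x x' hx hx' => simp only [map_add, LinearMap.add_apply, hx, hx']; abel
  | hsmul c x hx => simp [hx]
  | hb n =>
    induction y using basis_induction (basis K) with
    | h0 => simp
    | hadd x x' hx hx' => simp only [map_add, LinearMap.add_apply, hx, hx']; abel
    | hsmul c x hx => simp [hx]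
    | hb m =>
      induction z using basis_induction (basis K) with
      | h0 => simp
      | hadd x x' hx hx' => simp only [map_add, hx, hx']; abel
      | hsmul c x hx => simp [hx]
      | hb k =>
        change bracketMap K (e K n) (bracketMap K (e K m) (e K k)) =
          bracketMap K (bracketMap K (e K n) (e K m)) (e K k) +
            bracketMap K (e K m) (bracketMap K (e K n) (e K k))
        simp only [bracketMap_e, map_smul, LinearMap.smul_apply, smul_smul]
        rw [← add_assoc n m k, show m + (n + k) = n + m + k by ring, ← add_smul]
        congr 1
        push_cast
        ring

instance : LieRing (WittAlgebra K) where
  bracket x y := bracketMap K x y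
  add_lie x y z := by simp
  lie_add x y z := by simp
  lie_self x := bracketMap_self K x
  leibniz_lie x y z := bracketMap_leibniz K x y z

instance : LieAlgebra K (WittAlgebra K) where
  lie_smul c x y := map_smul (bracketMap K x) c y

theorem lie_e (n m : ℤ) : ⁅e K n, e K m⁆ = ((m : K) - (n : K)) • e K (n + m) :=
  bracketMap_e K n m

/-- The span of the `e n` with `n ∈ s`, where `s` is closed under sums of distinct elements. -/
def spanSubalgebra (s : Set ℤ) (hs : ∀ n ∈ s, ∀ m ∈ s, n ≠ m → n + m ∈ s) :
    LieSubalgebra K (WittAlgebra K) where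
  toSubmodule := Submodule.span K (e K '' s)
  lie_mem' {x y} hx hy := by
    change bracketMap K x y ∈ Submodule.span K (e K '' s)
    refine Submodule.span_induction₂
      (p := fun x y _ _ => bracketMap K x y ∈ Submodule.span K (e K '' s)) ?_ ?_ ?_ ?_ ?_ ?_ ?_
      hx hy
    · rintro _ _ ⟨n, hn, rfl⟩ ⟨m, hm, rfl⟩
      rw [bracketMap_e]
      by_cases h : n = m
      · simp [h]
      · exact Submodule.smul_mem _ _ (Submodule.subset_span ⟨_, hs n hn m hm h, rfl⟩)
    · intro y _; simp
    · intro x _; simp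
    · intro x y z _ _ _ h h'; simpa using add_mem h h'
    · intro x y z _ _ _ h h'; simpa using add_mem h h'
    · intro c x y _ _ h; simpa using Submodule.smul_mem _ c h
    · intro c x y _ _ h; simpa using Submodule.smul_mem _ c h

/-- The positive Witt algebra `W₊`, spanned by the `e n` with `n ≥ 1`. -/
def positive : LieSubalgebra K (WittAlgebra K) :=
  spanSubalgebra K {n | 1 ≤ n} (fun n hn m hm _ => by simp only [Set.mem_ofPred_eq] at *; omega)

/-- The Cartan algebra `𝐖₁`, spanned by the `e n` with `n ≥ -1`
(`e n` corresponds to the derivation `x ^ (n + 1) d/dx` of `K[x]`). -/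
def cartan : LieSubalgebra K (WittAlgebra K) :=
  spanSubalgebra K {n | -1 ≤ n} (fun n hn m hm _ => by simp only [Set.mem_ofPred_eq] at *; omega)

end WittAlgebra

/-! ### The Virasoro algebra -/

/-- The underlying vector space of the Virasoro algebra: the Witt algebra plus a line `K z`. -/
def VirasoroAlgebra (K : Type*) [Field K] : Type _ := WittAlgebra K × K

namespace VirasoroAlgebra

variable (K : Type*) [Field K]

instance : AddCommGroup (VirasoroAlgebra K) := inferInstanceAs (AddCommGroup (WittAlgebra K × K))
instance : Module K (VirasoroAlgebra K) := inferInstanceAs (Module K (WittAlgebra K × K))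

/-- The basis elements `e n`. -/
def e (n : ℤ) : VirasoroAlgebra K := (WittAlgebra.e K n, 0)

/-- The central basis element `z`. -/
def z : VirasoroAlgebra K := (0, 1)

/-- The bilinear form with `(e n, e m) ↦ (n ^ 3 - n) / 12` if `n + m = 0`, and `0` otherwise. -/
def cocycle : WittAlgebra K →ₗ[K] WittAlgebra K →ₗ[K] K :=
  (WittAlgebra.basis K).constr K fun n => (WittAlgebra.basis K).constr K fun m =>
    if n + m = 0 then ((n : K) ^ 3 - (n : K)) / 12 else 0

theorem cocycle_e (n m : ℤ) :
    cocycle K (WittAlgebra.e K n) (WittAlgebra.e K m) =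
      if n + m = 0 then ((n : K) ^ 3 - (n : K)) / 12 else 0 := by
  simp [cocycle, WittAlgebra.e]

theorem cocycle_skew (x y : WittAlgebra K) : cocycle K y x = - cocycle K x y := by
  induction x using basis_induction (WittAlgebra.basis K) with
  | h0 => simp
  | hadd x x' hx hx' => simp only [map_add, LinearMap.add_apply, hx, hx']; ring
  | hsmul c x hx => simp [hx]
  | hb n =>
    induction y using basis_induction (WittAlgebra.basis K) with
    | h0 => simp
    | hadd x x' hx hx' => simp only [map_add, LinearMap.add_apply, hx, hx']; ring
    | hsmul c x hx => simp [hx]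
    | hb m =>
      change cocycle K (WittAlgebra.e K m) (WittAlgebra.e K n) =
        - cocycle K (WittAlgebra.e K n) (WittAlgebra.e K m)
      rw [cocycle_e, cocycle_e, add_comm m n]
      split_ifs with h
      · obtain rfl : m = -n := by omega
        push_cast; ring
      · simp

theorem cocycle_self (x : WittAlgebra K) : cocycle K x x = 0 := by
  induction x using basis_induction (WittAlgebra.basis K) with
  | h0 => simp
  | hadd x y hx hy => simp [hx, hy, cocycle_skew K x y]
  | hsmul c x hx => simp [hx]
  | hb n =>
    change cocycle K (WittAlgebra.e K n) (WittAlgebra.e K n) = 0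
    rw [cocycle_e]
    split_ifs with h
    · obtain rfl : n = 0 := by omega
      simp
    · rfl

theorem cocycle_leibniz (x y z : WittAlgebra K) :
    cocycle K x ⁅y, z⁆ = cocycle K ⁅x, y⁆ z + cocycle K y ⁅x, z⁆ := by
  induction x using basis_induction (WittAlgebra.basis K) with
  | h0 => simp
  | hadd x x' hx hx' => simp only [map_add, add_lie, LinearMap.add_apply, hx, hx']; ring
  | hsmul c x hx => simp [hx, mul_add]
  | hb n =>
    induction y using basis_induction (WittAlgebra.basis K) with
    | h0 => simp
    | hadd x x' hx hx' =>
      simp only [map_add, add_lie, lie_add, LinearMap.add_apply, hx, hx']; ring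
    | hsmul c x hx => simp [hx, mul_add]
    | hb m =>
      induction z using basis_induction (WittAlgebra.basis K) with
      | h0 => simp
      | hadd x x' hx hx' => simp only [map_add, lie_add, hx, hx']; ring
      | hsmul c x hx => simp [hx, mul_add]
      | hb k =>
        change cocycle K (WittAlgebra.e K n) ⁅WittAlgebra.e K m, WittAlgebra.e K k⁆ =
          cocycle K ⁅WittAlgebra.e K n, WittAlgebra.e K m⁆ (WittAlgebra.e K k) +
            cocycle K (WittAlgebra.e K m) ⁅WittAlgebra.e K n, WittAlgebra.e K k⁆
        simp only [WittAlgebra.lie_e, map_smul, LinearMap.smul_apply, cocycle_e, smul_eq_mul]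
        rw [← add_assoc n m k, show m + (n + k) = n + m + k by ring]
        split_ifs with h
        · obtain rfl : k = -n - m := by omega
          push_cast; ring
        · simp

instance : LieRing (VirasoroAlgebra K) where
  bracket p q := (⁅p.1, q.1⁆, cocycle K p.1 q.1)
  add_lie p q r := by
    refine Prod.ext ?_ ?_
    · exact add_lie p.1 q.1 r.1
    · exact congrArg (fun f => f r.1) ((cocycle K).map_add p.1 q.1)
  lie_add p q r := Prod.ext (lie_add p.1 q.1 r.1) ((cocycle K p.1).map_add q.1 r.1)
  lie_self p := Prod.ext (lie_self p.1) (cocycle_self K p.1)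
  leibniz_lie p q r := Prod.ext (leibniz_lie p.1 q.1 r.1) (cocycle_leibniz K p.1 q.1 r.1)

instance : LieAlgebra K (VirasoroAlgebra K) where
  lie_smul c p q := Prod.ext (lie_smul c p.1 q.1) ((cocycle K p.1).map_smul c q.1)

theorem lie_e (n m : ℤ) :
    ⁅e K n, e K m⁆ = ((m : K) - (n : K)) • e K (n + m) +
      (if n + m = 0 then ((n : K) ^ 3 - (n : K)) / 12 else 0) • z K := by
  refine Prod.ext ?_ ?_
  · change ⁅WittAlgebra.e K n, WittAlgebra.e K m⁆ =
      ((m : K) - (n : K)) • WittAlgebra.e K (n + m) + (_ : K) • (0 : WittAlgebra K)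
    rw [WittAlgebra.lie_e, smul_zero, add_zero]
  · change cocycle K (WittAlgebra.e K n) (WittAlgebra.e K m) =
      ((m : K) - (n : K)) • (0 : K) + (_ : K) • (1 : K)
    rw [cocycle_e]; simp

theorem lie_z (p : VirasoroAlgebra K) : ⁅p, z K⁆ = 0 :=
  Prod.ext (lie_zero p.1) ((cocycle K p.1).map_zero)

end VirasoroAlgebra

end

/-! The proof follows the Ritt–Raudenbush basis theorem of differential algebra, with Poisson
brackets in the role of derivations.

The abstract half reduces both conclusions to `GenericallyFinite`: each prime Poisson ideal `P` has
a finite subset `G` and an element `s ∉ P` such that `s P ⊆ Q` for every radical Poisson ideal `Q`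
containing `G`. Chain-compactness stands in for finite generation. By Zorn, if it fails, some
radical Poisson ideal is maximal among its failures. That ideal is prime, because the radical
Poisson ideals generated by `(I, a)` and `(I, b)` multiply into `I` as soon as `ab ∈ I`, and then
`s` and `G` give a contradiction. Finite decomposition into primes follows from the chain condition
by noetherian induction.

The concrete half is `IsWittBracket.genericallyFinite`. If `P` is stable under all partial
derivatives, it is extended from the noetherian ring of constants. Otherwise some `f ∈ P` has a
partial derivative outside `P`. Modulo the derivatives of `f` that lie in `P`, the element `{X i,
f}` is a combination of variables shifted by `v i`, whose extreme coefficients are nonzero multiples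
of `∂f/∂X a` and `∂f/∂X b`. After inverting `s = ∂f/∂X a * ∂f/∂X b`, every variable of large index
is expressed through those of smaller absolute index. Hence only finitely many variables remain, and
Hilbert's basis theorem applies. -/

noncomputable section

/-! ### The basis theorem for radical Poisson ideals. -/

namespace PoissonBracket

variable {R A : Type*} [CommRing R] [CommRing A] [Algebra R A]

/-- A radical Poisson ideal. -/
def IsRadicalPoisson (B : PoissonBracket R A) (I : Ideal A) : Prop :=
  I.IsRadical ∧ B.IsPoissonIdeal I

/-- The hypothesis of the basis theorem: up to multiplication by an element outside of it, every
prime Poisson ideal is finitely generated as a radical Poisson ideal. -/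
def GenericallyFinite (B : PoissonBracket R A) : Prop :=
  ∀ P : Ideal A, P.IsPrime → B.IsPoissonIdeal P → ∃ s ∉ P, ∃ G : Finset A, (∀ g ∈ G, g ∈ P) ∧
    ∀ Q : Ideal A, B.IsRadicalPoisson Q → (∀ g ∈ G, g ∈ Q) → ∀ h ∈ P, s * h ∈ Q

variable (B : PoissonBracket R A)

theorem IsRadicalPoisson.sInf {s : Set (Ideal A)} (hs : ∀ I ∈ s, B.IsRadicalPoisson I) :
    B.IsRadicalPoisson (sInf s) := by
  refine ⟨fun x hx => ?_, fun a f hf => ?_⟩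
  · obtain ⟨n, hn⟩ := hx
    exact Submodule.mem_sInf.2 fun I hI => (hs I hI).1 ⟨n, Submodule.mem_sInf.1 hn I hI⟩
  · exact Submodule.mem_sInf.2 fun I hI => (hs I hI).2 a f (Submodule.mem_sInf.1 hf I hI)

theorem IsRadicalPoisson.mem_of_pow {B : PoissonBracket R A} {I : Ideal A}
    (hI : B.IsRadicalPoisson I) {x : A} (n : ℕ) (hx : x ^ n ∈ I) : x ∈ I :=
  hI.1 ⟨n, hx⟩

/-- The smallest radical Poisson ideal that contains a set. -/
def radicalPoissonClosure (s : Set A) : Ideal A :=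
  sInf {I | B.IsRadicalPoisson I ∧ s ⊆ I}

theorem isRadicalPoisson_closure (s : Set A) :
    B.IsRadicalPoisson (B.radicalPoissonClosure s) :=
  IsRadicalPoisson.sInf B fun _ hI => hI.1

theorem subset_closure (s : Set A) : s ⊆ B.radicalPoissonClosure s := fun _ hx =>
  Submodule.mem_sInf.2 fun _ hI => hI.2 hx

theorem closure_le {s : Set A} {I : Ideal A} (hI : B.IsRadicalPoisson I) (hs : s ⊆ I) :
    B.radicalPoissonClosure s ≤ I :=
  sInf_le ⟨hI, hs⟩

theorem closure_mono {s t : Set A} (h : s ⊆ t) :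
    B.radicalPoissonClosure s ≤ B.radicalPoissonClosure t :=
  B.closure_le (B.isRadicalPoisson_closure t) (h.trans (B.subset_closure t))

/-- The quotient of a radical Poisson ideal by an element is a radical Poisson ideal. -/
theorem IsRadicalPoisson.quotient {B : PoissonBracket R A} {I : Ideal A}
    (hI : B.IsRadicalPoisson I) (b : A) :
    B.IsRadicalPoisson (Submodule.comap (LinearMap.mulLeft A b) I) := by
  refine ⟨fun x hx => ?_, fun a f hf => ?_⟩
  · obtain ⟨n, hn⟩ := hx
    simp only [Submodule.mem_comap, LinearMap.mulLeft_apply] at hn ⊢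
    refine hI.mem_of_pow (n + 1) ?_
    rw [show (b * x) ^ (n + 1) = (b ^ n * x) * (b * x ^ n) by ring]
    exact I.mul_mem_left _ hn
  · simp only [Submodule.mem_comap, LinearMap.mulLeft_apply] at hf ⊢
    have h := hI.2 a _ hf
    rw [B.leibniz] at h
    -- Both `b{a,f} + f{a,b}` and `bf` lie in `I`; they generate the square of `b{a,f}`, so
    -- radicality is what makes the quotient Poisson.
    refine hI.mem_of_pow 2 ?_
    rw [show (b * B.bracket a f) ^ 2 = b * B.bracket a f * (b * B.bracket a f + f * B.bracket a b)
      - B.bracket a f * B.bracket a b * (b * f) by ring]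
    exact I.sub_mem (I.mul_mem_left _ h) (I.mul_mem_left _ hf)

theorem mul_mem_of_mem_closure {I : Ideal A} (hI : B.IsRadicalPoisson I) {s : Set A} {b x : A}
    (hs : ∀ a ∈ s, b * a ∈ I) (hx : x ∈ B.radicalPoissonClosure s) : b * x ∈ I :=
  B.closure_le (hI.quotient b) hs hx

/-- Two passages to a quotient ideal: first `b` multiplies the closure of `(I, a)` into `I`, then
each `x` in that closure multiplies the closure of `(I, b)` into `I`. -/
theorem mul_mem_of_mem_closure_insert {I : Ideal A} (hI : B.IsRadicalPoisson I) {a b x y : A}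
    (hab : a * b ∈ I) (hx : x ∈ B.radicalPoissonClosure (insert a I))
    (hy : y ∈ B.radicalPoissonClosure (insert b I)) : x * y ∈ I := by
  refine B.mul_mem_of_mem_closure hI ?_ hy
  rintro c (rfl | hc)
  · rw [mul_comm]
    refine B.mul_mem_of_mem_closure hI ?_ hx
    rintro d (rfl | hd)
    · rwa [mul_comm]
    · exact I.mul_mem_left _ hd
  · exact I.mul_mem_left _ hc

theorem IsRadicalPoisson.sSup_of_isChain {c : Set (Ideal A)}
    (hc : ∀ I ∈ c, B.IsRadicalPoisson I) (hchain : IsChain (· ≤ ·) c) (hne : c.Nonempty) :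
    B.IsRadicalPoisson (sSup c) := by
  have hmem : ∀ x, x ∈ sSup c ↔ ∃ I ∈ c, x ∈ I := fun x =>
    Submodule.mem_sSup_of_directed hne hchain.directedOn
  refine ⟨fun x hx => ?_, fun a f hf => ?_⟩
  · obtain ⟨n, hn⟩ := hx
    obtain ⟨I, hI, h⟩ := (hmem _).1 hn
    exact (hmem _).2 ⟨I, hI, (hc I hI).mem_of_pow n h⟩
  · obtain ⟨I, hI, h⟩ := (hmem _).1 hf
    exact (hmem _).2 ⟨I, hI, (hc I hI).2 a f h⟩

/-- An ideal is chain-compact if it is contained in a member of every nonempty chain of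
radical Poisson ideals whose union contains it. -/
def IsChainCompact (I : Ideal A) : Prop :=
  ∀ c : Set (Ideal A), (∀ J ∈ c, B.IsRadicalPoisson J) → IsChain (· ≤ ·) c → c.Nonempty →
    I ≤ sSup c → ∃ J ∈ c, I ≤ J

/-- If the radical Poisson closure of `P` and `a` is chain-compact and `P` is contained in the
union of a chain, then `P` is contained in the closure of `a` and some member of the chain. -/
theorem exists_le_closure_insert {P : Ideal A} {a : A}
    (h : B.IsChainCompact (B.radicalPoissonClosure (insert a P))) {c : Set (Ideal A)}
    (hchain : IsChain (· ≤ ·) c) (hne : c.Nonempty)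
    (hle : P ≤ sSup c) : ∃ J ∈ c, P ≤ B.radicalPoissonClosure (insert a J) := by
  have hmono : Monotone fun J : Ideal A => B.radicalPoissonClosure (insert a (J : Set A)) :=
    fun I J hIJ => B.closure_mono (Set.insert_subset_insert hIJ)
  have hchain' := hmono.isChain_image hchain
  have hrad : ∀ I ∈ (fun J : Ideal A => B.radicalPoissonClosure (insert a (J : Set A))) '' c,
      B.IsRadicalPoisson I := by
    rintro _ ⟨J, _, rfl⟩
    exact B.isRadicalPoisson_closure _
  have hle' : B.radicalPoissonClosure (insert a P) ≤
      sSup ((fun J : Ideal A => B.radicalPoissonClosure (insert a (J : Set A))) '' c) := by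
    refine B.closure_le (IsRadicalPoisson.sSup_of_isChain B hrad hchain' (hne.image _)) ?_
    rintro x (rfl | hx)
    · obtain ⟨J, hJ⟩ := hne
      exact Submodule.mem_sSup_of_mem (Set.mem_image_of_mem _ hJ)
        (B.subset_closure _ (Set.mem_insert _ _))
    · obtain ⟨J, hJ, hxJ⟩ := (Submodule.mem_sSup_of_directed hne hchain.directedOn).1 (hle hx)
      exact Submodule.mem_sSup_of_mem (Set.mem_image_of_mem _ hJ)
        (B.subset_closure _ (Set.mem_insert_of_mem _ hxJ))
  obtain ⟨_, ⟨J, hJ, rfl⟩, h'⟩ := h _ hrad hchain' (hne.image _) hle'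
  exact ⟨J, hJ, le_trans (fun x hx => B.subset_closure _ (Set.mem_insert_of_mem _ hx)) h'⟩

theorem exists_mem_le_of_isChain {c : Set (Ideal A)} (hchain : IsChain (· ≤ ·) c)
    {I J : Ideal A} (hI : I ∈ c) (hJ : J ∈ c) : ∃ L ∈ c, I ≤ L ∧ J ≤ L := by
  obtain ⟨L, hL, h⟩ := hchain.directedOn I hI J hJ
  exact ⟨L, hL, h⟩

theorem exists_mem_forall_mem_of_isChain {c : Set (Ideal A)} (hchain : IsChain (· ≤ ·) c)
    (hne : c.Nonempty) (G : Finset A) (hG : ∀ g ∈ G, g ∈ sSup c) :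
    ∃ J ∈ c, ∀ g ∈ G, g ∈ J := by
  classical
  induction G using Finset.induction_on with
  | empty => exact ⟨hne.some, hne.some_mem, by simp⟩
  | insert a G _ ih =>
    obtain ⟨J, hJ, h⟩ := ih fun g hg => hG g (Finset.mem_insert_of_mem hg)
    obtain ⟨I, hI, haI⟩ := (Submodule.mem_sSup_of_directed hne hchain.directedOn).1
      (hG a (Finset.mem_insert_self _ _))
    obtain ⟨L, hL, hIL, hJL⟩ := exists_mem_le_of_isChain hchain hI hJ
    refine ⟨L, hL, fun g hg => ?_⟩
    rcases Finset.mem_insert.1 hg with rfl | hg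
    · exact hIL haI
    · exact hJL (h g hg)

/-- If `ab ∈ P` with neither factor in `P`, maximality makes the closures of `(P, a)` and `(P, b)`
chain-compact. So one member `J` of the chain contains `ab` and has `P` inside the closures of both
`(J, a)` and `(J, b)`; then `x * x ∈ J` for `x ∈ P`, and `J` is radical. -/
theorem isPrime_of_maximal_not_isChainCompact {P : Ideal A} (hP : B.IsRadicalPoisson P)
    (hnot : ¬ B.IsChainCompact P)
    (hmax : ∀ J, B.IsRadicalPoisson J → P < J → B.IsChainCompact J) : P.IsPrime := by
  have hlt : ∀ a ∉ P, P < B.radicalPoissonClosure (insert a P) := fun a ha =>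
    lt_of_le_of_ne (fun x hx => B.subset_closure _ (Set.mem_insert_of_mem _ hx)) fun h =>
      ha (h ▸ B.subset_closure _ (Set.mem_insert a _))
  refine ⟨?_, fun {a b} hab => ?_⟩
  · rintro rfl
    refine hnot fun c _ hchain hne hle => ?_
    obtain ⟨J, hJ, h⟩ := (Submodule.mem_sSup_of_directed hne hchain.directedOn).1
      (hle (Submodule.mem_top (x := (1 : A))))
    exact ⟨J, hJ, ((Ideal.eq_top_iff_one J).2 h).ge⟩
  · by_contra! hcon
    refine hnot fun c hc hchain hne hle => ?_
    obtain ⟨J₁, hJ₁, h₁⟩ := B.exists_le_closure_insert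
      (hmax _ (B.isRadicalPoisson_closure _) (hlt a hcon.1)) hchain hne hle
    obtain ⟨J₂, hJ₂, h₂⟩ := B.exists_le_closure_insert
      (hmax _ (B.isRadicalPoisson_closure _) (hlt b hcon.2)) hchain hne hle
    obtain ⟨J₃, hJ₃, h₃⟩ := (Submodule.mem_sSup_of_directed hne hchain.directedOn).1 (hle hab)
    obtain ⟨J₄, hJ₄, h₁₄, h₂₄⟩ := exists_mem_le_of_isChain hchain hJ₁ hJ₂
    obtain ⟨J, hJ, h₄, h₃'⟩ := exists_mem_le_of_isChain hchain hJ₄ hJ₃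
    refine ⟨J, hJ, fun x hx => (hc J hJ).mem_of_pow 2 ?_⟩
    rw [pow_two]
    exact B.mul_mem_of_mem_closure_insert (hc J hJ) (h₃' h₃)
      (B.closure_mono (Set.insert_subset_insert (h₁₄.trans h₄)) (h₁ hx))
      (B.closure_mono (Set.insert_subset_insert (h₂₄.trans h₄)) (h₂ hx))

/-- A maximal counterexample `P` is prime. Some member `J` of the chain contains `G`, hence `s P`,
and also has `P` inside the closure of `(J, s)`. Multiplying that closure by `x ∈ P` lands in `J`,
so `x ^ 2 ∈ J`. -/
theorem GenericallyFinite.isChainCompact {B : PoissonBracket R A} (hB : B.GenericallyFinite)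
    {I : Ideal A} (hI : B.IsRadicalPoisson I) : B.IsChainCompact I := by
  by_contra hnot
  obtain ⟨P, -, hP⟩ := zorn_le_nonempty₀ {J | B.IsRadicalPoisson J ∧ ¬ B.IsChainCompact J}
    (fun c hcs hchain y hy => by
      have hrad : ∀ J ∈ c, B.IsRadicalPoisson J := fun J hJ => (hcs hJ).1
      -- Zorn applies because a chain-compact union of a chain would equal one of its members.
      refine ⟨sSup c, ⟨IsRadicalPoisson.sSup_of_isChain B hrad hchain ⟨y, hy⟩, fun h => ?_⟩,
        fun z hz => le_sSup hz⟩
      obtain ⟨J, hJ, hle⟩ := h c hrad hchain ⟨y, hy⟩ le_rfl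
      exact (hcs hJ).2 (le_antisymm hle (le_sSup hJ) ▸ h)) I ⟨hI, hnot⟩
  have hmax : ∀ J, B.IsRadicalPoisson J → P < J → B.IsChainCompact J := fun J hJ hlt => by
    by_contra h
    exact hP.not_gt ⟨hJ, h⟩ hlt
  have hprime := B.isPrime_of_maximal_not_isChainCompact hP.prop.1 hP.prop.2 hmax
  obtain ⟨s, hs, G, hG, hsG⟩ := hB P hprime hP.prop.1.2
  refine hP.prop.2 fun c hc hchain hne hle => ?_
  have hlt : P < B.radicalPoissonClosure (insert s P) :=
    lt_of_le_of_ne (fun x hx => B.subset_closure _ (Set.mem_insert_of_mem _ hx)) fun h =>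
      hs (h ▸ B.subset_closure _ (Set.mem_insert s _))
  obtain ⟨J₁, hJ₁, h₁⟩ := B.exists_le_closure_insert
    (hmax _ (B.isRadicalPoisson_closure _) hlt) hchain hne hle
  obtain ⟨J₂, hJ₂, h₂⟩ := exists_mem_forall_mem_of_isChain hchain hne G fun g hg => hle (hG g hg)
  obtain ⟨J, hJ, h₁', h₂'⟩ := exists_mem_le_of_isChain hchain hJ₁ hJ₂
  refine ⟨J, hJ, fun x hx => (hc J hJ).mem_of_pow 2 ?_⟩
  rw [pow_two]
  refine B.mul_mem_of_mem_closure (hc J hJ) ?_ (h₁ hx)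
  rintro a (rfl | ha)
  · rw [mul_comm]
    exact hsG J (hc J hJ) (fun g hg => h₂' (h₂ g hg)) x hx
  · exact J.mul_mem_left _ (h₁' ha)

/-- The basis theorem for radical Poisson ideals. -/
theorem GenericallyFinite.accOnRadicalPoissonIdeals {B : PoissonBracket R A}
    (hB : B.GenericallyFinite) : B.ACCOnRadicalPoissonIdeals := by
  intro I hI hmono
  have hm : Monotone I := monotone_nat_of_le_succ hmono
  have hc : ∀ J ∈ Set.range I, B.IsRadicalPoisson J := by rintro _ ⟨n, rfl⟩; exact hI n
  have hchain : IsChain (· ≤ ·) (Set.range I) := hm.isChain_range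
  have hne := Set.range_nonempty I
  obtain ⟨_, ⟨N, rfl⟩, hN⟩ := hB.isChainCompact
    (IsRadicalPoisson.sSup_of_isChain B hc hchain hne) _ hc hchain hne le_rfl
  exact ⟨N, fun n hn => le_antisymm ((le_sSup (Set.mem_range_self n)).trans hN) (hm hn)⟩

variable {B}

/-- Noetherian induction: if `ab ∈ J` violates primality, then `J` is the intersection of the
strictly larger closures of `(J, a)` and `(J, b)`, since their product lies in `J`. -/
theorem ACCOnRadicalPoissonIdeals.isFiniteInterOfPrimePoisson (hB : B.ACCOnRadicalPoissonIdeals)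
    {I : Ideal A} (hI : B.IsRadicalPoisson I) : B.IsFiniteInterOfPrimePoisson I := by
  classical
  have hwf : WellFoundedGT {J : Ideal A // B.IsRadicalPoisson J} := by
    rw [wellFoundedGT_iff_monotone_chain_condition]
    intro a
    obtain ⟨N, hN⟩ := hB (fun n => (a n).1) (fun n => (a n).2) fun n => a.monotone n.le_succ
    exact ⟨N, fun m hm => Subtype.ext (hN m hm).symm⟩
  suffices h : ∀ J : {J : Ideal A // B.IsRadicalPoisson J}, B.IsFiniteInterOfPrimePoisson J.1 from
    h ⟨I, hI⟩
  intro J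
  induction J using hwf.wf.induction with
  | _ J ih =>
  obtain ⟨J, hJ⟩ := J
  by_cases htop : J = ⊤
  · exact ⟨∅, by simp, by simpa using htop⟩
  by_cases hprime : J.IsPrime
  · exact ⟨{J}, by simpa using ⟨hprime, hJ.2⟩, by simp⟩
  rw [Ideal.isPrime_iff] at hprime
  push Not at hprime
  obtain ⟨a, b, hab, ha, hb⟩ := hprime htop
  have hle : ∀ x, J ≤ B.radicalPoissonClosure (insert x J) := fun x y hy =>
    B.subset_closure _ (Set.mem_insert_of_mem _ hy)
  have key : ∀ x ∉ J, B.IsFiniteInterOfPrimePoisson (B.radicalPoissonClosure (insert x J)) :=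
    fun x hx => ih ⟨_, B.isRadicalPoisson_closure _⟩ <|
      lt_of_le_of_ne (hle x) fun h => hx (by
        have h' : J = _ := congrArg Subtype.val h
        rw [h']
        exact B.subset_closure _ (Set.mem_insert x _))
  obtain ⟨s, hs, hs'⟩ := key a ha
  obtain ⟨t, ht, ht'⟩ := key b hb
  refine ⟨s ∪ t, fun P hP => (Finset.mem_union.1 hP).elim (hs P) (ht P), ?_⟩
  rw [Finset.coe_union, sInf_union, ← hs', ← ht']
  refine le_antisymm (le_inf (hle a) (hle b)) fun x hx => hJ.mem_of_pow 2 ?_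
  rw [pow_two]
  exact B.mul_mem_of_mem_closure_insert hJ hab hx.1 hx.2

end PoissonBracket

/-! ### Derivations and partial derivatives of polynomials. -/

open MvPolynomial

theorem MvPolynomial.derivation_eq_sum_pderiv {σ R : Type*} [CommRing R]
    (D : Derivation R (MvPolynomial σ R) (MvPolynomial σ R)) (f : MvPolynomial σ R) :
    D f = ∑ i ∈ f.vars, pderiv i f * D (X i) := by
  classical
  have hsum : ∀ (t : Finset σ) (g : MvPolynomial σ R), (∑ i ∈ t, D (X i) • pderiv (R := R) i) g =
      ∑ i ∈ t, pderiv i g * D (X i) := by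
    intro t g
    induction t using Finset.induction_on with
    | empty => simp
    | insert i t hi ih =>
      rw [Finset.sum_insert hi, Finset.sum_insert hi, Derivation.add_apply, ih,
        Derivation.smul_apply, smul_eq_mul, mul_comm]
  rw [← hsum]
  refine derivation_eq_of_forall_mem_vars fun j hj => ?_
  rw [hsum, Finset.sum_eq_single j]
  · simp
  · intro i _ hij
    simp [pderiv_X_of_ne hij.symm]
  · exact fun h => (h hj).elim

theorem MvPolynomial.pderiv_mem_supported {σ R : Type*} [CommRing R] {s : Set σ}
    {f : MvPolynomial σ R} (hf : f ∈ supported R s) (i : σ) : pderiv i f ∈ supported R s := by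
  classical
  induction hf using Algebra.adjoin_induction with
  | mem x hx =>
    obtain ⟨j, -, rfl⟩ := hx
    rw [pderiv_X, Pi.single_apply]
    split_ifs
    · exact Subalgebra.one_mem _
    · exact Subalgebra.zero_mem _
  | algebraMap r =>
    rw [algebraMap_eq, pderiv_C]
    exact Subalgebra.zero_mem _
  | add x y _ _ hx hy =>
    rw [map_add]
    exact Subalgebra.add_mem _ hx hy
  | mul x y hx' hy' hx hy =>
    rw [pderiv_mul]
    exact Subalgebra.add_mem _ (Subalgebra.mul_mem _ hx hy') (Subalgebra.mul_mem _ hx' hy)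

/-- Over a `ℚ`-algebra, an ideal stable under all partial derivatives is extended from the ring
of coefficients. -/
theorem MvPolynomial.map_comap_C_of_pderiv_mem {σ R : Type*} [CommRing R] [Algebra ℚ R]
    {P : Ideal (MvPolynomial σ R)} (hP : ∀ f ∈ P, ∀ i, pderiv i f ∈ P) :
    (P.comap C).map C = P := by
  refine le_antisymm Ideal.map_comap_le fun f hf => mem_map_C_iff.2 ?_
  -- Induction on a strict bound for the total degree; the bound `0` forces `f = 0`.
  suffices h : ∀ n : ℕ, ∀ f ∈ P, (∀ m, coeff m f ≠ 0 → m.degree < n) →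
      ∀ m, coeff m f ∈ P.comap C by
    obtain ⟨n, hn⟩ := (f.support.image Finsupp.degree).bddAbove
    exact h (n + 1) f hf fun m hm => Nat.lt_succ_of_le <| hn <| by
      simpa using ⟨m, hm, rfl⟩
  intro n
  induction n with
  | zero =>
    intro f _ h m
    have : coeff m f = 0 := by
      by_contra h'
      exact absurd (h m h') (by simp)
    rw [this]
    exact Ideal.zero_mem _
  | succ n ih =>
    intro f hf h
    -- A coefficient at a nonconstant monomial reappears in a partial derivative, multiplied by an
    -- exponent that is invertible over `ℚ`. The constant coefficient then follows by subtraction.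
    have key : ∀ m ≠ 0, coeff m f ∈ P.comap C := by
      intro m hm
      obtain ⟨i, hi⟩ := Finsupp.ne_iff.1 hm
      have hle : Finsupp.single i 1 ≤ m :=
        Finsupp.single_le_iff.2 (Nat.one_le_iff_ne_zero.2 hi)
      have h1 := ih (pderiv i f) (hP f hf i) (fun m' hm' => by
        rw [coeff_pderiv] at hm'
        have h2 := h _ (left_ne_zero_of_mul hm')
        rw [map_add, Finsupp.degree_single] at h2
        omega) (m - Finsupp.single i 1)
      rw [coeff_pderiv, tsub_add_cancel_of_le hle] at h1
      have hmi : ((m - Finsupp.single i 1 : σ →₀ ℕ) i : R) + 1 = algebraMap ℚ R (m i) := by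
        have h3 : (m - Finsupp.single i 1 : σ →₀ ℕ) i + 1 = m i := by
          simpa using Nat.sub_add_cancel (Nat.one_le_iff_ne_zero.2 hi)
        rw [map_natCast, ← h3]
        push_cast
        rfl
      have h4 : (m i : ℚ) ≠ 0 := Nat.cast_ne_zero.2 hi
      have h5 := Ideal.mul_mem_right (algebraMap ℚ R (m i : ℚ)⁻¹) _ h1
      rwa [hmi, mul_assoc, ← map_mul, mul_inv_cancel₀ h4, map_one, mul_one] at h5
    intro m
    by_cases hm : m = 0
    · subst hm
      have h1 : f - C (coeff 0 f) ∈ P := by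
        refine Ideal.map_comap_le (f := C) (mem_map_C_iff.2 fun m => ?_)
        classical
        rw [coeff_sub, coeff_C]
        split_ifs with h
        · subst h
          simp
        · simpa using key m (Ne.symm h)
      simpa using P.sub_mem hf h1
    · exact key m hm

/-! ### Reduction to a subalgebra up to powers of an element. -/

section Saturation

variable {R A : Type*} [CommRing R] [CommRing A] [Algebra R A]

/-- The elements of `A` that lie in `B + J` up to multiplication by a power of `s`. -/
def saturatedSubalgebra (B : Subalgebra R A) (J : Ideal A) (s : A) (hs : s ∈ B) :
    Subalgebra R A where
  carrier := {h | ∃ k : ℕ, ∃ c ∈ B, s ^ k * h - c ∈ J}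
  mul_mem' := by
    rintro x y ⟨k, c, hc, h⟩ ⟨l, d, hd, h'⟩
    refine ⟨k + l, c * d, B.mul_mem hc hd, ?_⟩
    rw [show s ^ (k + l) * (x * y) - c * d =
      (s ^ l * y) * (s ^ k * x - c) + c * (s ^ l * y - d) by ring]
    exact J.add_mem (J.mul_mem_left _ h) (J.mul_mem_left _ h')
  add_mem' := by
    rintro x y ⟨k, c, hc, h⟩ ⟨l, d, hd, h'⟩
    refine ⟨k + l, s ^ l * c + s ^ k * d, B.add_mem (B.mul_mem (B.pow_mem hs _) hc)
      (B.mul_mem (B.pow_mem hs _) hd), ?_⟩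
    rw [show s ^ (k + l) * (x + y) - (s ^ l * c + s ^ k * d) =
      s ^ l * (s ^ k * x - c) + s ^ k * (s ^ l * y - d) by ring]
    exact J.add_mem (J.mul_mem_left _ h) (J.mul_mem_left _ h')
  algebraMap_mem' r := ⟨0, algebraMap R A r, B.algebraMap_mem r, by simp⟩

variable {B : Subalgebra R A} {J : Ideal A} {s : A} {hs : s ∈ B}

theorem le_saturatedSubalgebra : B ≤ saturatedSubalgebra B J s hs :=
  fun x hx => ⟨0, x, hx, by simp⟩

theorem mem_saturatedSubalgebra_of_mem {x : A} (hx : x ∈ J) : x ∈ saturatedSubalgebra B J s hs :=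
  ⟨0, 0, B.zero_mem, by simpa using hx⟩

theorem mem_saturatedSubalgebra_of_mul {x : A} (hx : s * x ∈ saturatedSubalgebra B J s hs) :
    x ∈ saturatedSubalgebra B J s hs := by
  obtain ⟨k, c, hc, h⟩ := hx
  exact ⟨k + 1, c, hc, by rwa [pow_succ, mul_assoc]⟩

end Saturation

/-! ### Elimination of variables for Witt-type brackets. -/

section Witt

variable {K R ι : Type*} [Field K] [CommRing R] [Algebra K R]

/-- A Poisson bracket on `R[X i]` with constants `R`, for which `X i ↦ e (v i)` satisfies the
bracket relations of the Witt algebra, except for those that involve `e 0` on the right. -/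
structure IsWittBracket (B : PoissonBracket K (MvPolynomial ι R)) (v : ι → ℤ) : Prop where
  injective : Function.Injective v
  pos : ∀ k : ℤ, 1 ≤ k → ∃ i, v i = k
  neg : (∃ c, ∀ i, c ≤ v i) ∨ ∀ k, ∃ i, v i = k
  bracket_C : ∀ i r, B.bracket (X i) (C r) = 0
  bracket_X : ∀ i j k, v k = v i + v j → v k ≠ 0 →
    B.bracket (X i) (X j) = C (algebraMap K R (v j - v i)) * X k

variable {B : PoissonBracket K (MvPolynomial ι R)} {v : ι → ℤ}

/-- Since `X i` commutes with the constants, bracketing with it is an `R`-linear derivation, hence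
determined by its values on variables. -/
theorem IsWittBracket.bracket_eq_sum (hB : IsWittBracket B v) (i : ι) (f : MvPolynomial ι R) :
    B.bracket (X i) f = ∑ j ∈ f.vars, pderiv j f * B.bracket (X i) (X j) := by
  let D : Derivation R (MvPolynomial ι R) (MvPolynomial ι R) :=
    Derivation.mk' { toFun := fun g => B.bracket (X i) g
                     map_add' := fun g h => map_add _ g h
                     map_smul' := fun r g => by
                      rw [smul_eq_C_mul, B.leibniz, hB.bracket_C]
                      simp [smul_eq_C_mul] } fun g h => B.leibniz _ g h
  exact derivation_eq_sum_pderiv D f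

/-- The step of the elimination: if `f ∈ J`, and the variable `X j` is extremal in `f`, then
`pderiv j f * X k` can be expressed through other variables `X l`. -/
theorem IsWittBracket.pderiv_mul_X_mem [CharZero K] (hB : IsWittBracket B v) {J : Ideal (MvPolynomial ι R)}
    (hJ : B.IsPoissonIdeal J) {f : MvPolynomial ι R} (hf : f ∈ J)
    (T : Subalgebra R (MvPolynomial ι R)) (hJT : ∀ x ∈ J, x ∈ T)
    (hT : ∀ j, pderiv j f ∈ T)
    {i j k : ι} (hk : v k = v i + v j) (hk0 : v k ≠ 0) (hij : v j ≠ v i)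
    (h : ∀ m ∈ f.vars, m ≠ j → pderiv m f ∉ J →
      ∃ l, v l = v i + v m ∧ v l ≠ 0 ∧ X l ∈ T) :
    pderiv j f * X k ∈ T := by
  classical
  by_cases hj : j ∈ f.vars
  · have h1 := hJT _ (hJ (X i) f hf)
    rw [hB.bracket_eq_sum, ← Finset.add_sum_erase _ _ hj] at h1
    have h2 : ∑ m ∈ f.vars.erase j, pderiv m f * B.bracket (X i) (X m) ∈ T := by
      refine T.sum_mem fun m hm => ?_
      by_cases hmJ : pderiv m f ∈ J
      · exact hJT _ (J.mul_mem_right _ hmJ)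
      · obtain ⟨l, hl, hl0, hlT⟩ := h m (Finset.mem_of_mem_erase hm) (Finset.ne_of_mem_erase hm) hmJ
        rw [hB.bracket_X i m l hl hl0]
        exact T.mul_mem (hT m) (T.mul_mem (T.algebraMap_mem _) hlT)
    have h3 := T.sub_mem h1 h2
    rw [add_sub_cancel_right, hB.bracket_X i j k hk hk0] at h3
    have h4 : (v j - v i : K) ≠ 0 := sub_ne_zero.2 (Int.cast_injective.ne hij)
    have h5 := T.mul_mem (T.algebraMap_mem (algebraMap K R (v j - v i : K)⁻¹)) h3
    rwa [algebraMap_eq, mul_left_comm, ← mul_assoc (C _) (C _), ← C_mul, ← map_mul,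
      inv_mul_cancel₀ h4, map_one, C_1, one_mul] at h5
  · rw [pderiv_eq_zero_of_notMem_vars hj, zero_mul]
    exact T.zero_mem

/-- Induction on `|v k|` rewrites each variable outside the window `|v i| ≤ M` through variables of
smaller absolute index. Large positive indices are removed with the top variable `b` of `f` modulo
`J`, large negative ones with the bottom variable `a`; the product of the two derivatives serves
both directions. -/
theorem IsWittBracket.saturatedSubalgebra_eq_top [CharZero K] (hB : IsWittBracket B v)
    {J : Ideal (MvPolynomial ι R)} (hJ : B.IsPoissonIdeal J) {f : MvPolynomial ι R} (hf : f ∈ J)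
    {a b : ι} (hab : ∀ m, pderiv m f ∉ J → v a ≤ v m ∧ v m ≤ v b) {M : ℤ}
    (hM : |v a| + |v b| + |v a| + |v b| ≤ M)
    (hneg : (∀ i, -M ≤ v i) ∨ ∀ k, ∃ i, v i = k) (hfM : ∀ i ∈ f.vars, |v i| ≤ M)
    (hs : pderiv a f * pderiv b f ∈ supported R {i | |v i| ≤ M}) :
    saturatedSubalgebra (supported R {i | |v i| ≤ M}) J _ hs = ⊤ := by
  set T := saturatedSubalgebra (supported R {i | |v i| ≤ M}) J _ hs
  have hpd : ∀ j, pderiv j f ∈ supported R {i | |v i| ≤ M} :=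
    pderiv_mem_supported (mem_supported.2 hfM)
  have hX : ∀ n : ℕ, ∀ k, |v k| < n → X k ∈ T := by
    intro n
    induction n with
    | zero =>
      intro k hk
      have := abs_nonneg (v k)
      simp at hk
      omega
    | succ n ih =>
      intro k hk
      by_cases hkM : |v k| ≤ M
      · exact le_saturatedSubalgebra (Algebra.subset_adjoin ⟨k, hkM, rfl⟩)
      have hb := abs_le.1 (le_refl |v b|)
      have ha := abs_le.1 (le_refl |v a|)
      push Not at hkM
      rcases le_or_gt 0 (v k) with h0 | h0
      -- Take `v i = v k - v b`, so that the shift carries `b` to `k` and the other relevant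
      -- variables strictly below `k`. The bound on `M` keeps `v i` and all shifted indices
      -- positive, hence away from the excluded index `0`, and gives `v i ≠ v b`.
      · rw [abs_of_nonneg h0] at hkM hk
        obtain ⟨i, hi⟩ := hB.pos (v k - v b) (by omega)
        have h1 := hB.pderiv_mul_X_mem hJ hf T (fun x hx => mem_saturatedSubalgebra_of_mem hx)
          (fun j => le_saturatedSubalgebra (hpd j)) (i := i) (j := b) (k := k)
          (by omega) (by omega) (by omega) (fun m hm hmb hmJ => by
            have h2 := hab m hmJ
            have h3 := hB.injective.ne hmb
            obtain ⟨l, hl⟩ := hB.pos (v i + v m) (by omega)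
            refine ⟨l, hl, by omega, ih l ?_⟩
            rw [abs_of_nonneg (by omega)]
            omega)
        refine mem_saturatedSubalgebra_of_mul ?_
        rw [mul_assoc]
        exact T.mul_mem (le_saturatedSubalgebra (hpd a)) h1
      · rw [abs_of_neg h0] at hkM hk
        -- An index below `-M` rules out the alternative bounded below, so every integer is an index
        -- and the argument can be mirrored with `a`.
        have hall : ∀ k, ∃ i, v i = k := hneg.resolve_left fun h => by
          have := h k
          omega
        obtain ⟨i, hi⟩ := hall (v k - v a)
        have h1 := hB.pderiv_mul_X_mem hJ hf T (fun x hx => mem_saturatedSubalgebra_of_mem hx)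
          (fun j => le_saturatedSubalgebra (hpd j)) (i := i) (j := a) (k := k)
          (by omega) (by omega) (by omega) (fun m hm hmb hmJ => by
            have h2 := hab m hmJ
            have h3 := hB.injective.ne hmb
            obtain ⟨l, hl⟩ := hall (v i + v m)
            refine ⟨l, hl, by omega, ih l ?_⟩
            rw [abs_of_neg (by omega)]
            omega)
        refine mem_saturatedSubalgebra_of_mul ?_
        have h2 := T.mul_mem (le_saturatedSubalgebra (hpd b)) h1
        rwa [← mul_assoc, mul_comm (pderiv b f)] at h2
  rw [eq_top_iff, ← adjoin_range_X, Algebra.adjoin_le_iff]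
  rintro _ ⟨k, rfl⟩
  exact hX (|v k|.toNat + 1) k (by have := abs_nonneg (v k); push_cast; omega)

/-- For `x ∈ P`, elimination gives `s ^ k * x = c` modulo `Q ⊓ P` with `c` in a finitely generated
subalgebra. Then `c` lies in the trace of `P` there, whose finitely many generators were put into
`G`; so `s ^ k * x ∈ Q`, and radicality of `Q` reduces the exponent to one. -/
theorem IsWittBracket.genericallyFinite [CharZero K] [IsNoetherianRing R] (hB : IsWittBracket B v) :
    B.GenericallyFinite := by
  classical
  let _ : Algebra ℚ R := Algebra.compHom R (algebraMap ℚ K)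
  intro P hP hPB
  by_cases hpd : ∀ f ∈ P, ∀ i, pderiv i f ∈ P
  · have h := map_comap_C_of_pderiv_mem hpd
    obtain ⟨G, hG⟩ := (isNoetherianRing_iff_ideal_fg R).1 inferInstance (P.comap C)
    refine ⟨1, (Ideal.ne_top_iff_one P).1 hP.ne_top, G.image C, fun g hg => ?_,
      fun Q hQ hGQ x hx => ?_⟩
    · obtain ⟨r, hr, rfl⟩ := Finset.mem_image.1 hg
      have : r ∈ P.comap C := hG ▸ Ideal.subset_span hr
      exact this
    · rw [one_mul]
      refine (?_ : P ≤ Q) hx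
      rw [← h, Ideal.map_le_iff_le_comap, ← hG, Ideal.span_le]
      exact fun r hr => hGQ _ (Finset.mem_image_of_mem _ hr)
  · push Not at hpd
    obtain ⟨f, hf, m₀, hm₀⟩ := hpd
    have hvars : ∀ m, pderiv m f ∉ P → m ∈ f.vars := fun m hm => by
      by_contra h
      exact hm (by rw [pderiv_eq_zero_of_notMem_vars h]; exact P.zero_mem)
    set V := f.vars.filter fun m => pderiv m f ∉ P with hV
    have hmemV : ∀ m, m ∈ V ↔ pderiv m f ∉ P := fun m => by
      rw [hV, Finset.mem_filter]
      exact ⟨fun h => h.2, fun h => ⟨hvars m h, h⟩⟩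
    obtain ⟨a, ha, hamin⟩ := V.exists_min_image v ⟨m₀, (hmemV _).2 hm₀⟩
    obtain ⟨b, hb, hbmax⟩ := V.exists_max_image v ⟨m₀, (hmemV _).2 hm₀⟩
    -- The window must leave room for the index shifts, reach below a lower bound of `v` if there is
    -- one, and contain all variables of `f`; `M` adds up the three bounds.
    obtain ⟨M, hM, hneg, hfM⟩ : ∃ M : ℤ, |v a| + |v b| + |v a| + |v b| ≤ M ∧
        ((∀ i, -M ≤ v i) ∨ ∀ k, ∃ i, v i = k) ∧ ∀ i ∈ f.vars, |v i| ≤ M := by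
      obtain ⟨N, hN⟩ := (f.vars.image fun i => |v i|).bddAbove
      have hfN : ∀ i ∈ f.vars, |v i| ≤ N := fun i hi => hN (Finset.mem_image_of_mem _ hi)
      have hab := add_nonneg (add_nonneg (abs_nonneg (v a)) (abs_nonneg (v b)))
        (add_nonneg (abs_nonneg (v a)) (abs_nonneg (v b)))
      have hN0 := (abs_nonneg _).trans (hfN m₀ (hvars m₀ hm₀))
      have hneg : ∃ c : ℤ, 0 ≤ c ∧ ((∀ i, -c ≤ v i) ∨ ∀ k, ∃ i, v i = k) := by
        rcases hB.neg with ⟨c, hc⟩ | h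
        · exact ⟨|c|, abs_nonneg c, Or.inl fun i => (neg_abs_le c).trans (hc i)⟩
        · exact ⟨0, le_rfl, Or.inr h⟩
      obtain ⟨c, hc0, hc⟩ := hneg
      refine ⟨|v a| + |v b| + |v a| + |v b| + N + c, by omega,
        hc.imp_left fun h i => le_trans (by omega) (h i), fun i hi => ?_⟩
      have := hfN i hi
      omega
    have hs : pderiv a f * pderiv b f ∈ supported R {i | |v i| ≤ M} :=
      Subalgebra.mul_mem _ (pderiv_mem_supported (mem_supported.2 hfM) a)
        (pderiv_mem_supported (mem_supported.2 hfM) b)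
    have hfg : (supported R {i | |v i| ≤ M}).FG := by
      refine Subalgebra.fg_def.2 ⟨_, Set.Finite.image X (Set.Finite.of_finite_image
        ((Set.finite_Icc (-M) M).subset ?_) hB.injective.injOn), rfl⟩
      rintro _ ⟨i, hi, rfl⟩
      exact abs_le.1 hi
    have hnoeth := isNoetherianRing_of_fg hfg
    obtain ⟨G, hG⟩ := (isNoetherianRing_iff_ideal_fg _).1 hnoeth
      (P.comap (supported R {i | |v i| ≤ M}).val)
    -- Besides `f` and the generators of the trace of `P`, `G` contains the derivatives of `f` that
    -- lie in `P`. Thus a derivative outside `Q ⊓ P` is already outside `P`, and its index is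
    -- between those of `a` and `b`.
    refine ⟨pderiv a f * pderiv b f, fun h => (hP.mem_or_mem h).elim ((hmemV a).1 ha)
      ((hmemV b).1 hb), insert f ((f.vars.filter fun m => pderiv m f ∈ P).image
        (fun m => pderiv m f) ∪ G.image Subtype.val), ?_, ?_⟩
    · simp only [Finset.mem_insert, Finset.mem_union, Finset.mem_image, Finset.mem_filter]
      rintro g (rfl | ⟨m, ⟨-, hm⟩, rfl⟩ | ⟨c, hc, rfl⟩)
      · exact hf
      · exact hm
      · have : c ∈ P.comap (supported R {i | |v i| ≤ M}).val := hG ▸ Ideal.subset_span hc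
        exact this
    · simp only [Finset.mem_insert, Finset.mem_union, Finset.mem_image, Finset.mem_filter]
      intro Q hQ hGQ x hx
      -- Elimination is done modulo `Q ⊓ P` rather than `Q`, so that the remainder `c` of an element
      -- of `P` stays in `P`.
      have hJ : B.IsPoissonIdeal (Q ⊓ P) := fun y g hg => ⟨hQ.2 y g hg.1, hPB y g hg.2⟩
      have htop := hB.saturatedSubalgebra_eq_top hJ (f := f) ⟨hGQ f (Or.inl rfl), hf⟩ (a := a)
        (b := b) (fun m hm => by
          have h : pderiv m f ∉ P := fun hmP => by
            by_cases hmv : m ∈ f.vars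
            · exact hm ⟨hGQ _ (Or.inr (Or.inl ⟨m, ⟨hmv, hmP⟩, rfl⟩)), hmP⟩
            · exact hm (by rw [pderiv_eq_zero_of_notMem_vars hmv]; exact Ideal.zero_mem _)
          exact ⟨hamin m ((hmemV m).2 h), hbmax m ((hmemV m).2 h)⟩) hM hneg hfM hs
      obtain ⟨k, c, hc, hck⟩ : x ∈ saturatedSubalgebra _ _ _ hs := htop ▸ Algebra.mem_top
      have hcP : c ∈ P := by
        simpa using P.sub_mem (P.mul_mem_left ((pderiv a f * pderiv b f) ^ k) hx) hck.2
      have hcQ : c ∈ Q := by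
        have h1 : (⟨c, hc⟩ : supported R {i | |v i| ≤ M}) ∈
          P.comap (supported R {i | |v i| ≤ M}).val := hcP
        rw [← hG] at h1
        have h2 : Ideal.span (G : Set (supported R {i | |v i| ≤ M})) ≤
            Q.comap (supported R {i | |v i| ≤ M}).val :=
          Ideal.span_le.2 fun g hg => hGQ _ (Or.inr (Or.inr ⟨g, hg, rfl⟩))
        exact h2 h1
      have hkQ : (pderiv a f * pderiv b f) ^ k * x ∈ Q := by
        simpa using Q.add_mem hck.1 hcQ
      refine hQ.mem_of_pow (k + 1) ?_
      rw [show (pderiv a f * pderiv b f * x) ^ (k + 1) =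
        (pderiv a f * pderiv b f * x ^ k) * ((pderiv a f * pderiv b f) ^ k * x) by ring]
      exact Q.mul_mem_left _ hkQ

end Witt

/-! ### Transport to polynomial rings. -/

namespace PoissonBracket

variable {R A A' : Type*} [CommRing R] [CommRing A] [Algebra R A] [CommRing A'] [Algebra R A']

/-- Transport of a Poisson bracket along an isomorphism of algebras. -/
def transport (B : PoissonBracket R A) (e : A ≃ₐ[R] A') : PoissonBracket R A' where
  bracket := (B.bracket.compl₁₂ e.symm.toLinearMap e.symm.toLinearMap).compr₂ e.toLinearMap
  self a := by simp [B.self]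
  jacobi a b c := by
    have h := congrArg e (B.jacobi (e.symm a) (e.symm b) (e.symm c))
    simpa using h
  leibniz a b c := by simp [B.leibniz]

theorem transport_apply (B : PoissonBracket R A) (e : A ≃ₐ[R] A') (a b : A') :
    (B.transport e).bracket a b = e (B.bracket (e.symm a) (e.symm b)) := rfl

theorem GenericallyFinite.of_transport {B : PoissonBracket R A} {e : A ≃ₐ[R] A'}
    (h : (B.transport e).GenericallyFinite) : B.GenericallyFinite := by
  classical
  have hcomap : ∀ P : Ideal A, B.IsPoissonIdeal P →
      (B.transport e).IsPoissonIdeal (P.comap e.symm) := fun P hP a f hf => by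
    rw [Ideal.mem_comap, transport_apply, AlgEquiv.symm_apply_apply]
    exact hP _ _ hf
  intro P hP hPB
  obtain ⟨s, hs, G, hG, hsG⟩ := h (P.comap e.symm) (hP.comap _) (hcomap P hPB)
  refine ⟨e.symm s, hs, G.image e.symm, fun g hg => ?_, fun Q hQ hGQ x hx => ?_⟩
  · obtain ⟨g', hg', rfl⟩ := Finset.mem_image.1 hg
    exact hG g' hg'
  · have h1 := hsG (Q.comap e.symm) ⟨hQ.1.comap _, hcomap Q hQ.2⟩
      (fun g hg => hGQ _ (Finset.mem_image_of_mem _ hg)) (e x) (by simpa using hx)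
    simpa using h1

theorem GenericallyFinite.basisTheorem {B : PoissonBracket R A} (h : B.GenericallyFinite) :
    B.ACCOnRadicalPoissonIdeals ∧ ∀ I : Ideal A, I.IsRadical → B.IsPoissonIdeal I →
      B.IsFiniteInterOfPrimePoisson I :=
  ⟨h.accOnRadicalPoissonIdeals, fun _ hI hI' =>
    h.accOnRadicalPoissonIdeals.isFiniteInterOfPrimePoisson ⟨hI, hI'⟩⟩

end PoissonBracket

variable (K : Type*) [Field K]

theorem isWittBracket_transport {L ι : Type*} [LieRing L] [LieAlgebra K L]
    (b : Module.Basis ι K L) (v : ι → ℤ) (hv : Function.Injective v)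
    (hpos : ∀ k : ℤ, 1 ≤ k → ∃ i, v i = k) (hneg : (∃ c, ∀ i, c ≤ v i) ∨ ∀ k, ∃ i, v i = k)
    (hb : ∀ i j k, v k = v i + v j → ⁅b i, b j⁆ = ((v j : K) - v i) • b k) :
    IsWittBracket ((LiePoisson.poissonBracket K L).transport
      (SymmetricAlgebra.equivMvPolynomial b)) v where
  injective := hv
  pos := hpos
  neg := hneg
  bracket_C i r := by
    rw [PoissonBracket.transport_apply, ← algebraMap_eq, AlgEquiv.commutes]
    exact (congrArg _ (LiePoisson.bracketMap_algebraMap_right K L r _)).trans (map_zero _)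
  bracket_X i j k h _ := by
    rw [PoissonBracket.transport_apply, SymmetricAlgebra.equivMvPolynomial_symm_X,
      SymmetricAlgebra.equivMvPolynomial_symm_X, LiePoisson.poissonBracket_ι, hb i j k h, map_smul,
      map_smul, SymmetricAlgebra.equivMvPolynomial_ι_apply, smul_eq_C_mul]
    rfl

/-! ### The Witt algebra and its subalgebras. -/

namespace WittAlgebra

theorem genericallyFinite [CharZero K] :
    (LiePoisson.poissonBracket K (WittAlgebra K)).GenericallyFinite :=
  PoissonBracket.GenericallyFinite.of_transport
    (isWittBracket_transport K (basis K) id Function.injective_id (fun k _ => ⟨k, rfl⟩)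
      (Or.inr fun k => ⟨k, rfl⟩) fun i j k h => by
        change k = i + j at h
        subst h
        exact lie_e K i j).genericallyFinite

/-- The basis `e n`, `n ∈ s`, of the subalgebra that it spans. -/
def spanSubalgebraBasis (s : Set ℤ) (hs : ∀ n ∈ s, ∀ m ∈ s, n ≠ m → n + m ∈ s) :
    Module.Basis s K (spanSubalgebra K s hs) :=
  (Module.Basis.span ((basis K).linearIndependent.comp ((↑) : s → ℤ)
    Subtype.val_injective)).map (LinearEquiv.ofEq _ _ (by
      change _ = Submodule.span K (e K '' s)
      rw [Set.range_comp, Subtype.range_coe]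
      rfl))

theorem coe_spanSubalgebraBasis (s : Set ℤ) (hs : ∀ n ∈ s, ∀ m ∈ s, n ≠ m → n + m ∈ s) (i : s) :
    (spanSubalgebraBasis K s hs i : WittAlgebra K) = e K i := by
  have h := Module.Basis.span_apply ((basis K).linearIndependent.comp ((↑) : s → ℤ)
    Subtype.val_injective) i
  rw [spanSubalgebraBasis, Module.Basis.map_apply, h]
  rfl

/-- Covers `W₊` and `𝐖₁` together: indices are bounded below, so only the upward elimination is ever
used. -/
theorem genericallyFinite_spanSubalgebra [CharZero K] (s : Set ℤ)
    (hs : ∀ n ∈ s, ∀ m ∈ s, n ≠ m → n + m ∈ s) (hpos : ∀ n, 1 ≤ n → n ∈ s)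
    (hbdd : ∃ c, ∀ n ∈ s, c ≤ n) :
    (LiePoisson.poissonBracket K (spanSubalgebra K s hs)).GenericallyFinite :=
  PoissonBracket.GenericallyFinite.of_transport
    (isWittBracket_transport K (spanSubalgebraBasis K s hs) (↑) Subtype.val_injective
      (fun k hk => ⟨⟨k, hpos k hk⟩, rfl⟩) (Or.inl <| hbdd.imp fun _ hc i => hc i i.2)
      fun i j k h => Subtype.ext <| by
        change ⁅(_ : WittAlgebra K), _⁆ = _ • (spanSubalgebraBasis K s hs k : WittAlgebra K)
        rw [coe_spanSubalgebraBasis,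
          coe_spanSubalgebraBasis, coe_spanSubalgebraBasis, h, lie_e]).genericallyFinite

end WittAlgebra

/-! ### The Virasoro algebra, with `K[z]` as ring of constants. -/

namespace VirasoroAlgebra

/-- The standard basis of the Virasoro algebra; the index `none` is that of the center. -/
def basis : Module.Basis (Option ℤ) K (VirasoroAlgebra K) :=
  (((WittAlgebra.basis K).prod (Module.Basis.singleton Unit K)).reindex
    (Equiv.optionEquivSumPUnit ℤ).symm).map (LinearEquiv.refl K (WittAlgebra K × K))

theorem basis_some (n : ℤ) : basis K (some n) = e K n := by
  have h : (((WittAlgebra.basis K).prod (Module.Basis.singleton Unit K)).reindex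
      (Equiv.optionEquivSumPUnit ℤ).symm) (some n) = (WittAlgebra.e K n, 0) := by
    rw [Module.Basis.reindex_apply]
    simp [WittAlgebra.e, Module.Basis.prod_apply]
  exact h

theorem basis_none : basis K none = z K := by
  have h : (((WittAlgebra.basis K).prod (Module.Basis.singleton Unit K)).reindex
      (Equiv.optionEquivSumPUnit ℤ).symm) none = (0, 1) := by
    rw [Module.Basis.reindex_apply]
    simp [Module.Basis.prod_apply]
  exact h

/-- The symmetric algebra of the Virasoro algebra as a polynomial ring over `K[z]`. -/
def symmetricAlgebraEquiv :
    SymmetricAlgebra K (VirasoroAlgebra K) ≃ₐ[K] MvPolynomial ℤ (Polynomial K) :=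
  (SymmetricAlgebra.equivMvPolynomial (basis K)).trans (optionEquivRight K ℤ)

theorem symmetricAlgebraEquiv_e (n : ℤ) :
    symmetricAlgebraEquiv K (SymmetricAlgebra.ι K _ (e K n)) = X n := by
  rw [← basis_some, symmetricAlgebraEquiv, AlgEquiv.trans_apply,
    SymmetricAlgebra.equivMvPolynomial_ι_apply, optionEquivRight_X_some]

theorem symmetricAlgebraEquiv_z :
    symmetricAlgebraEquiv K (SymmetricAlgebra.ι K _ (z K)) = C Polynomial.X := by
  rw [← basis_none, symmetricAlgebraEquiv, AlgEquiv.trans_apply,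
    SymmetricAlgebra.equivMvPolynomial_ι_apply, optionEquivRight_X_none]

theorem symmetricAlgebraEquiv_symm_X (n : ℤ) :
    (symmetricAlgebraEquiv K).symm (X n) = SymmetricAlgebra.ι K _ (e K n) := by
  rw [AlgEquiv.symm_apply_eq, symmetricAlgebraEquiv_e]

/-- Centrality of `z` makes `K[z]` constant, and the cocycle contributes only to brackets of total
index `0`, which `IsWittBracket` leaves unconstrained. -/
theorem isWittBracket : IsWittBracket ((LiePoisson.poissonBracket K
    (VirasoroAlgebra K)).transport (symmetricAlgebraEquiv K)) id where
  injective := Function.injective_id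
  pos k _ := ⟨k, rfl⟩
  neg := Or.inr fun k => ⟨k, rfl⟩
  bracket_C i r := by
    induction r using Polynomial.induction_on' with
    | add p q hp hq => rw [C_add, map_add, hp, hq, add_zero]
    | monomial n a =>
      have h : C (Polynomial.monomial n a) = algebraMap K (MvPolynomial ℤ (Polynomial K)) a *
          symmetricAlgebraEquiv K (SymmetricAlgebra.ι K _ (z K)) ^ n := by
        rw [symmetricAlgebraEquiv_z, ← C_pow, IsScalarTower.algebraMap_apply K (Polynomial K),
          algebraMap_eq, ← C_mul, ← Polynomial.C_mul_X_pow_eq_monomial]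
        rfl
      have hz : (LiePoisson.poissonBracket K (VirasoroAlgebra K)).bracket
          (SymmetricAlgebra.ι K _ (e K i)) (SymmetricAlgebra.ι K _ (z K)) = 0 := by
        rw [LiePoisson.poissonBracket_ι, lie_z, map_zero]
      have hzn : ∀ n : ℕ, (LiePoisson.poissonBracket K (VirasoroAlgebra K)).bracket
          (SymmetricAlgebra.ι K _ (e K i)) (SymmetricAlgebra.ι K _ (z K) ^ n) = 0 := by
        intro n
        induction n with
        | zero =>
          rw [pow_zero, ← map_one (algebraMap K _)]
          exact LiePoisson.bracketMap_algebraMap_right K _ _ _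
        | succ n ih => rw [pow_succ, PoissonBracket.leibniz, hz, ih, mul_zero, mul_zero, add_zero]
      rw [h, PoissonBracket.transport_apply, symmetricAlgebraEquiv_symm_X, map_mul, map_pow,
        AlgEquiv.symm_apply_apply, AlgEquiv.commutes, PoissonBracket.leibniz, hzn, mul_zero,
        zero_add]
      exact (congrArg _ ((congrArg _ (LiePoisson.bracketMap_algebraMap_right K _ _ _)).trans
        (mul_zero _))).trans (map_zero _)
  bracket_X i j k h h0 := by
    change k = i + j at h
    change k ≠ 0 at h0
    rw [PoissonBracket.transport_apply, symmetricAlgebraEquiv_symm_X,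
      symmetricAlgebraEquiv_symm_X, LiePoisson.poissonBracket_ι, lie_e, ← h, if_neg h0, zero_smul,
      add_zero, map_smul, map_smul, symmetricAlgebraEquiv_e, Algebra.smul_def]
    rfl

end VirasoroAlgebra

end

theorem mainTheorem7 (K : Type*) [Field K] [CharZero K] :
    -- the Witt algebra `W`
    ((LiePoisson.poissonBracket K (WittAlgebra K)).ACCOnRadicalPoissonIdeals ∧
      ∀ I : Ideal (SymmetricAlgebra K (WittAlgebra K)), I.IsRadical →
        (LiePoisson.poissonBracket K (WittAlgebra K)).IsPoissonIdeal I →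
        (LiePoisson.poissonBracket K (WittAlgebra K)).IsFiniteInterOfPrimePoisson I) ∧
    -- the positive Witt algebra `W₊`
    ((LiePoisson.poissonBracket K (WittAlgebra.positive K)).ACCOnRadicalPoissonIdeals ∧
      ∀ I : Ideal (SymmetricAlgebra K (WittAlgebra.positive K)), I.IsRadical →
        (LiePoisson.poissonBracket K (WittAlgebra.positive K)).IsPoissonIdeal I →
        (LiePoisson.poissonBracket K (WittAlgebra.positive K)).IsFiniteInterOfPrimePoisson I) ∧
    -- the Cartan algebra `𝐖₁`
    ((LiePoisson.poissonBracket K (WittAlgebra.cartan K)).ACCOnRadicalPoissonIdeals ∧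
      ∀ I : Ideal (SymmetricAlgebra K (WittAlgebra.cartan K)), I.IsRadical →
        (LiePoisson.poissonBracket K (WittAlgebra.cartan K)).IsPoissonIdeal I →
        (LiePoisson.poissonBracket K (WittAlgebra.cartan K)).IsFiniteInterOfPrimePoisson I) ∧
    -- the Virasoro algebra
    ((LiePoisson.poissonBracket K (VirasoroAlgebra K)).ACCOnRadicalPoissonIdeals ∧
      ∀ I : Ideal (SymmetricAlgebra K (VirasoroAlgebra K)), I.IsRadical →
        (LiePoisson.poissonBracket K (VirasoroAlgebra K)).IsPoissonIdeal I →
        (LiePoisson.poissonBracket K (VirasoroAlgebra K)).IsFiniteInterOfPrimePoisson I) :=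
  ⟨(WittAlgebra.genericallyFinite K).basisTheorem,
    (WittAlgebra.genericallyFinite_spanSubalgebra K {n | 1 ≤ n} _ (fun _ hn => hn)
      ⟨1, fun _ hn => hn⟩).basisTheorem,
    (WittAlgebra.genericallyFinite_spanSubalgebra K {n | -1 ≤ n} _
      (fun n hn => show -1 ≤ n by omega) ⟨-1, fun _ hn => hn⟩).basisTheorem,
    (PoissonBracket.GenericallyFinite.of_transport
      (VirasoroAlgebra.isWittBracket K).genericallyFinite).basisTheorem⟩
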